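/- Let $(X_i)_{i\ge 1}$ be a sequence of finite sets with $|X_i|\ge 2$ for all $i$, and let $T$ be the associated spherically symmetric rooted tree: its vertices of level $n\ge 0$ are the elements of $L_n=X_1\times\dots\times X_n$ (the root being the empty sequence), and $u\in L_n$ is joined by an edge to $v\in L_{n+1}$ exactly if $u$ is a prefix of $v$. For $u\in L_n$ let $D(u)\subseteq L_{n+1}$ be the set of descendants of $u$, i.e. the vertices of level $n+1$ adjacent to $u$. Let $\mathrm{Aut}(T)$ be the profinite group of root-preserving automorphisms of $T$, in which the pointwise stabilisers of the levels $L_n$ form a neighbourhood base of the identity, and let $\partial T$ be the boundary of $T$, i.e. the set of infinite non-backtracking paths starting at the root. A subgroup $G\le \mathrm{Aut}(T)$ acts locally $2$-transitively if $G$ acts transitively on every level $L_n$ and, for all $n$ and all distinct $u,v\in L_n$, the group $\mathrm{St}_G(u)\cap \mathrm{St}_G(v)$ acts transitively on $D(u)\times D(v)$; here $\mathrm{St}_G(v)$ denotes the stabiliser of the vertex $v$ in $G$. For $\xi\in\partial T$, the stabiliser $P_\xi$ of $\xi$ in $G$ is called a parabolic subgroup of $G$. For a profinite group $H$ and a closed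 subgroup $K$, the pair $(H,K)$ is called a Gelfand pair if the representation of $H$ on the space $C^\infty(H/K,\mathbb C)$ of locally constant functions, $(\rho(h)f)(x)=f(h^{-1}x)$, is multiplicity-free, i.e. every smooth irreducible complex representation of $H$ (one in which every vector has an open stabiliser) occurs in it with multiplicity at most one. Theorem 1.2 (Local-global principle). Let $G$ be a closed subgroup of $\mathrm{Aut}(T)$ which acts locally $2$-transitively on $T$, and let $\xi\in\partial T$. Then $(G,P_\xi)$ is a Gelfand pair if and only if $(\mathrm{St}_G(v),\mathrm{St}_G(u))$ is a Gelfand pair for every vertex $v$ of $T$ and every descendant $u\in D(v)$. -/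

import Mathlib

universe u

/-! ### Spherically symmetric rooted trees -/

/-- The vertices of the tree based on the sequence of sets `X 0, X 1, X 2, …`: the finite
sequences `(x₁, …, xₙ)` whose `(i+1)`-st entry lies in `X i`. The first component is the level. -/
abbrev Vertex (X : ℕ → Type u) : Type u := Σ n : ℕ, ((i : Fin n) → X i)

namespace Vertex

variable {X : ℕ → Type u}

/-- The level of a vertex, that is, the length of the sequence. -/
def level (v : Vertex X) : ℕ := v.1

/-- `u` is a prefix of `v`. -/
def IsPrefix (u v : Vertex X) : Prop :=
  ∃ h : u.1 ≤ v.1, ∀ i : Fin u.1, v.2 (Fin.castLE h i) = u.2 i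

/-- The root of the tree: the empty sequence. -/
def root (X : ℕ → Type u) : Vertex X := ⟨0, fun i => i.elim0⟩

end Vertex

/-- The spherically symmetric rooted tree based on `X`: there is an edge between a vertex `u` of
level `n` and a vertex `v` of level `n + 1` exactly if `u` is a prefix of `v`. -/
def rootedTree (X : ℕ → Type u) : SimpleGraph (Vertex X) where
  Adj u v := (v.level = u.level + 1 ∧ u.IsPrefix v) ∨ (u.level = v.level + 1 ∧ v.IsPrefix u)
  symm := ⟨fun _ _ h => h.symm⟩
  loopless := ⟨fun _ h => by rcases h with h | h <;> omega⟩

/-- The descendants of a vertex `u` of level `n`: the vertices of level `n + 1` which are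
incident to `u`. -/
def descendants {X : ℕ → Type u} (u : Vertex X) : Set (Vertex X) :=
  {w | w.level = u.level + 1 ∧ (rootedTree X).Adj u w}

/-! ### The group of root-preserving automorphisms -/

/-- The group `Aut T` of root-preserving graph automorphisms of the tree `T`. -/
abbrev RootedAut (X : ℕ → Type u) : Type u :=
  MulAction.stabilizer ((rootedTree X) ≃g (rootedTree X)) (Vertex.root X)

namespace RootedAut

variable {X : ℕ → Type u}

theorem adj_smul (g : RootedAut X) {u v : Vertex X} (h : (rootedTree X).Adj u v) :
    (rootedTree X).Adj (g • u) (g • v) :=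
  (SimpleGraph.Iso.map_adj_iff g.1).2 h

theorem smul_root (g : RootedAut X) : g • Vertex.root X = Vertex.root X := g.2

/-- The predecessor of a vertex is unique. -/
theorem parent_unique {p q v : Vertex X} (hp : v.level = p.level + 1) (hq : v.level = q.level + 1)
    (hpv : p.IsPrefix v) (hqv : q.IsPrefix v) : p = q := by
  obtain ⟨n, p⟩ := p
  obtain ⟨m, q⟩ := q
  simp only [Vertex.level] at hp hq
  obtain rfl : n = m := by omega
  obtain ⟨h₁, h₁p⟩ := hpv
  obtain ⟨h₂, h₂q⟩ := hqv
  congr 1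
  funext i
  exact (h₁p i).symm.trans (h₂q i)

/-- Every vertex of positive level has a predecessor. -/
theorem exists_parent {n : ℕ} (v : Vertex X) (hv : v.level = n + 1) :
    ∃ p : Vertex X, p.level = n ∧ p.IsPrefix v := by
  obtain ⟨m, v⟩ := v
  simp only [Vertex.level] at hv
  subst hv
  exact ⟨⟨n, fun i => v (Fin.castLE (Nat.le_succ n) i)⟩, rfl, ⟨Nat.le_succ n, fun _ => rfl⟩⟩

/-- Root-preserving automorphisms preserve the levels. -/
theorem level_smul (g : RootedAut X) (v : Vertex X) : (g • v).level = v.level := by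
  suffices H : ∀ n, ∀ v : Vertex X, v.level = n → (g • v).level = n from H _ v rfl
  intro n
  induction n using Nat.strong_induction_on with
  | _ n ih =>
    intro v hv
    rcases n with _ | n
    · have : v = Vertex.root X := by
        obtain ⟨m, v⟩ := v
        simp only [Vertex.level] at hv
        subst hv
        unfold Vertex.root
        congr 1
        funext i
        exact i.elim0
      rw [this, smul_root]
      rfl
    · obtain ⟨p, hp, hpv⟩ := exists_parent v hv
      have hgp := ih n (Nat.lt_succ_self n) p hp
      have hadj : (rootedTree X).Adj p v := Or.inl ⟨by omega, hpv⟩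
      rcases adj_smul g hadj with h | h
      · omega
      · exfalso
        rcases n with _ | n
        · omega
        · obtain ⟨q, hq, hqp⟩ := exists_parent p hp
          have hgq := ih n (by omega) q hq
          have hadj' : (rootedTree X).Adj q p := Or.inl ⟨by omega, hqp⟩
          rcases adj_smul g hadj' with h' | h'
          · have := smul_left_cancel g (parent_unique h.1 h'.1 h.2 h'.2)
            rw [this] at hv
            omega
          · omega

/-- The pointwise stabiliser of the `n`-th level. -/
def levelStabilizer (X : ℕ → Type u) (n : ℕ) : Subgroup (RootedAut X) where
  carrier := {g | ∀ v : Vertex X, v.level = n → g • v = v}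
  mul_mem' {a b} ha hb v hv := by rw [mul_smul, hb v hv, ha v hv]
  one_mem' v _ := one_smul _ v
  inv_mem' {a} ha v hv := by rw [inv_smul_eq_iff, ha v hv]

theorem levelStabilizer_succ_le [∀ i, Nonempty (X i)] (n : ℕ) :
    levelStabilizer X (n + 1) ≤ levelStabilizer X n := by
  intro g hg v hv
  obtain ⟨m, v⟩ := v
  simp only [Vertex.level] at hv
  subst hv
  let w : Vertex X := ⟨m + 1, Fin.snoc (α := fun i : Fin (m + 1) => X i) v
    (Classical.arbitrary (X m))⟩
  have hvw : Vertex.IsPrefix ⟨m, v⟩ w := ⟨Nat.le_succ m, fun i =>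
    Fin.snoc_castSucc (α := fun i : Fin (m + 1) => X i) (Classical.arbitrary (X m)) v i⟩
  have hadj : (rootedTree X).Adj ⟨m, v⟩ w := Or.inl ⟨rfl, hvw⟩
  have hgw : g • w = w := hg w rfl
  have hgv := level_smul g ⟨m, v⟩
  have hw : w.level = m + 1 := rfl
  have hv : Vertex.level (⟨m, v⟩ : Vertex X) = m := rfl
  rcases adj_smul g hadj with h | h
  · rw [hgw] at h
    exact parent_unique h.1 rfl h.2 hvw
  · rw [hgw] at h
    omega

theorem levelStabilizer_antitone [∀ i, Nonempty (X i)] : Antitone (levelStabilizer X) :=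
  antitone_nat_of_succ_le levelStabilizer_succ_le

/-- The pointwise stabilisers of the levels form a neighbourhood base of the identity for a group
topology on `Aut T`. -/
@[reducible]
def levelBasis (X : ℕ → Type u) [∀ i, Nonempty (X i)] : GroupFilterBasis (RootedAut X) where
  sets := Set.range fun n => (levelStabilizer X n : Set (RootedAut X))
  nonempty := Set.range_nonempty _
  inter_sets := by
    rintro _ _ ⟨m, rfl⟩ ⟨n, rfl⟩
    exact ⟨_, ⟨max m n, rfl⟩, Set.subset_inter
      (levelStabilizer_antitone (le_max_left m n)) (levelStabilizer_antitone (le_max_right m n))⟩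
  one' := by
    rintro _ ⟨n, rfl⟩
    exact one_mem (levelStabilizer X n)
  mul' := by
    rintro _ ⟨n, rfl⟩
    refine ⟨_, ⟨n, rfl⟩, ?_⟩
    rintro _ ⟨a, ha, b, hb, rfl⟩
    exact mul_mem (S := Subgroup (RootedAut X)) ha hb
  inv' := by
    rintro _ ⟨n, rfl⟩
    exact ⟨_, ⟨n, rfl⟩, fun a ha => inv_mem (S := Subgroup (RootedAut X)) ha⟩
  conj' := by
    rintro g _ ⟨n, rfl⟩
    refine ⟨_, ⟨n, rfl⟩, fun a ha v hv => ?_⟩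
    have h : a • g⁻¹ • v = g⁻¹ • v := ha _ ((level_smul g⁻¹ v).trans hv)
    rw [mul_smul, mul_smul, h, smul_inv_smul]

/-- The (profinite) topology of `Aut T`. -/
instance [∀ i, Nonempty (X i)] : TopologicalSpace (RootedAut X) := (levelBasis X).topology

instance [∀ i, Nonempty (X i)] : IsTopologicalGroup (RootedAut X) :=
  (levelBasis X).isTopologicalGroup

end RootedAut

/-! ### The boundary -/

/-- The boundary `∂T`: the infinite non-backtracking paths in the tree that start at the root. -/
@[ext]
structure Boundary (X : ℕ → Type u) where
  /-- The sequence of vertices of the path. -/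
  vertex : ℕ → Vertex X
  vertex_zero : vertex 0 = Vertex.root X
  adj : ∀ n, (rootedTree X).Adj (vertex n) (vertex (n + 1))
  nonbacktracking : ∀ n, vertex (n + 2) ≠ vertex n

/-- `Aut T` acts on the boundary by moving the vertices of a path. -/
instance Boundary.instMulAction {X : ℕ → Type u} : MulAction (RootedAut X) (Boundary X) where
  smul g ξ :=
    { vertex := fun n => g • ξ.vertex n
      vertex_zero := by rw [ξ.vertex_zero, RootedAut.smul_root]
      adj := fun n => RootedAut.adj_smul g (ξ.adj n)
      nonbacktracking := fun n h => ξ.nonbacktracking n (smul_left_cancel g h) }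
  one_smul ξ := Boundary.ext (funext fun _ => one_smul _ _)
  mul_smul g h ξ := Boundary.ext (funext fun _ => mul_smul g h _)

/-! ### Locally 2-transitive actions -/

section Actions

variable {X : ℕ → Type u}

/-- `G` acts transitively on every level of the tree. -/
def IsSphericallyTransitive (G : Subgroup (RootedAut X)) : Prop :=
  ∀ u v : Vertex X, u.level = v.level → ∃ g ∈ G, g • u = v

/-- `G` acts spherically transitively and, for any two distinct vertices `u`, `v` of the same
level, the common stabiliser of `u` and `v` in `G` acts transitively on `D(u) × D(v)`. -/
def IsLocallyTwoTransitive (G : Subgroup (RootedAut X)) : Prop :=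
  IsSphericallyTransitive G ∧
    ∀ u v : Vertex X, u.level = v.level → u ≠ v →
      ∀ a ∈ descendants u, ∀ b ∈ descendants v, ∀ a' ∈ descendants u, ∀ b' ∈ descendants v,
        ∃ g ∈ G, (g • u = u ∧ g • v = v) ∧ g • a = a' ∧ g • b = b'

/-- The stabiliser `St_G(v)` of a vertex `v`. -/
abbrev vertexStabilizer (G : Subgroup (RootedAut X)) (v : Vertex X) : Subgroup G :=
  MulAction.stabilizer G v

/-- The parabolic subgroup `P_ξ`: the stabiliser in `G` of a boundary point `ξ`. -/
abbrev parabolic (G : Subgroup (RootedAut X)) (ξ : Boundary X) : Subgroup G :=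
  MulAction.stabilizer G ξ

end Actions

/-! ### Gelfand pairs -/

section GelfandPairs

variable {H : Type u} [Group H] [TopologicalSpace H]

/-- A representation of a topological group is smooth if every vector has an open stabiliser. -/
def IsSmoothRep {V : Type*} [AddCommGroup V] [Module ℂ V] (π : Representation ℂ H V) : Prop :=
  ∀ w : V, IsOpen {h : H | π h w = w}

/-- The multiplicity `m(π, ρ) = dim Hom_H(π, ρ)` of an irreducible complex representation `π`
in `ρ`. -/
noncomputable def repMultiplicity {H : Type*} [Group H] {V : Type*} {W : Type*}
    [AddCommGroup V] [Module ℂ V] [AddCommGroup W] [Module ℂ W]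
    (π : Representation ℂ H V) (ρ : Representation ℂ H W) : Cardinal :=
  Module.rank ℂ (Representation.IntertwiningMap π ρ)

/-- A smooth representation of a profinite group is multiplicity-free if every smooth irreducible
representation occurs in it with multiplicity at most one. (Smooth irreducible representations of
a profinite group are finite-dimensional, so each is isomorphic to one on a space in `Type`.) -/
def IsMultiplicityFree {W : Type*} [AddCommGroup W] [Module ℂ W]
    (ρ : Representation ℂ H W) : Prop :=
  ∀ (V : Type) [AddCommGroup V] [Module ℂ V] (π : Representation ℂ H V),
    π.IsIrreducible → IsSmoothRep π → repMultiplicity π ρ ≤ 1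

/-- The representation of `H` on the space of locally constant functions `H ⧸ K → ℂ`, given by
`(ρ(h) f)(x) = f (h⁻¹ x)`. It is the smooth induction of the trivial representation of `K`. -/
def cosetRep [IsTopologicalGroup H] (K : Subgroup H) :
    Representation ℂ H (LocallyConstant (H ⧸ K) ℂ) where
  toFun h :=
    { toFun := fun f => f.comap ⟨fun x => h⁻¹ • x, continuous_const_smul h⁻¹⟩
      map_add' := fun _ _ => rfl
      map_smul' := fun _ _ => rfl }
  map_one' := by
    refine LinearMap.ext fun f => LocallyConstant.ext fun x => ?_
    change f ((1 : H)⁻¹ • x) = f x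
    rw [inv_one, one_smul]
  map_mul' a b := by
    refine LinearMap.ext fun f => LocallyConstant.ext fun x => ?_
    change f ((a * b)⁻¹ • x) = f (b⁻¹ • a⁻¹ • x)
    rw [mul_inv_rev, mul_smul]

/-- For a profinite group `H` and a closed subgroup `K`: `(H, K)` is a Gelfand pair if the
representation of `H` on the locally constant functions `H ⧸ K → ℂ` is multiplicity-free. -/
def IsGelfandPair [IsTopologicalGroup H] (K : Subgroup H) : Prop :=
  IsMultiplicityFree (cosetRep K)

end GelfandPairs

/-! By compactness, a locally constant function on G/P_ξ factors through some level L_n, which is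
the coset space of the stabiliser of the n-th vertex of ξ. So (G, P_ξ) is a Gelfand pair exactly if
the permutation representation on ℂ^{L_n} is multiplicity-free for every n. By complete reducibility
and Schur's lemma, this means that its endomorphism algebra, the G-invariant matrices over L_n, is
commutative (`OrbitalsCommute`). In the same way the local pair at v and u ∈ D(v) is governed by the
St_G(v)-invariant matrices over D(v).

What remains is matrix algebra along the parent map L_{n+1} → L_n, whose fibres are the sets D(v).
An invariant matrix on one fibre extends to a block diagonal invariant matrix on L_{n+1}, so
commutativity passes from levels to fibres (`OrbitalsCommute.equivariantFiber`).

Conversely, local 2-transitivity makes an invariant matrix over L_{n+1} constant on each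
off-diagonal block, so it is a block diagonal matrix plus a pullback from L_n. Block diagonal ones
commute by the local hypothesis and pullbacks by induction on n. A block diagonal one commutes with
every pullback, because by transitivity all its row and column sums are equal
(`OrbitalsCommute.of_base_of_fibers`). -/

/-! ### Commuting orbital matrices -/

section Orbitals

open MulAction

/-- A matrix indexed by an `H`-set is invariant if it is constant on the orbits of pairs. -/
def IsInvariantMatrix (H : Type*) {Y : Type*} [Group H] [MulAction H Y] (a : Matrix Y Y ℂ) : Prop :=
  ∀ (h : H) (x y : Y), a (h • x) (h • y) = a x y

/-- The invariant matrices of a finite `H`-set commute with each other. -/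
def OrbitalsCommute (H Y : Type*) [Group H] [MulAction H Y] [Fintype Y] : Prop :=
  ∀ a b : Matrix Y Y ℂ, IsInvariantMatrix H a → IsInvariantMatrix H b → a * b = b * a

/-- Only the permutations induced by `H` need to come from `H'`: then there are fewer `H'`-invariant
matrices, and a subset of commuting matrices commutes. -/
theorem OrbitalsCommute.of_equiv {H H' Y Y' : Type*} [Group H] [Group H'] [MulAction H Y]
    [MulAction H' Y'] [Fintype Y] [Fintype Y'] (e : Y ≃ Y')
    (he : ∀ h : H, ∃ h' : H', ∀ y, e (h • y) = h' • e y) (hc : OrbitalsCommute H Y) :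
    OrbitalsCommute H' Y' := by
  intro a b ha hb
  have key : ∀ c : Matrix Y' Y' ℂ, IsInvariantMatrix H' c →
      IsInvariantMatrix H (c.submatrix e e) := by
    intro c hc h x y
    obtain ⟨h', hh'⟩ := he h
    simp only [Matrix.submatrix_apply, hh']
    exact hc h' _ _
  have := hc _ _ (key a ha) (key b hb)
  rw [Matrix.submatrix_mul_equiv, Matrix.submatrix_mul_equiv] at this
  ext x y
  simpa using congrFun (congrFun this (e.symm x)) (e.symm y)

variable {G Y Z : Type*} [Group G] [MulAction G Y] [MulAction G Z]

/-- The fibre of an equivariant map, as a set acted upon by the stabiliser of the base point. -/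
def equivariantFiber (p : Z →[G] Y) (y : Y) : SubMulAction (stabilizer G y) Z where
  carrier := {z | p z = y}
  smul_mem' g z hz := by
    have hz : p z = y := hz
    change p (g.1 • z) = y
    rw [map_smul, hz]
    exact g.2

theorem mem_equivariantFiber {p : Z →[G] Y} {y : Y} {z : Z} :
    z ∈ equivariantFiber p y ↔ p z = y := Iff.rfl

theorem IsInvariantMatrix.submatrix {a : Matrix Y Y ℂ} (ha : IsInvariantMatrix G a)
    (p : Z →[G] Y) : IsInvariantMatrix G (a.submatrix p p) := by
  intro g x y
  simp only [Matrix.submatrix_apply, map_smul]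
  exact ha g _ _

open scoped Classical in
theorem card_equivariantFiber_smul [Fintype Z] (p : Z →[G] Y) (g : G) (y : Y) :
    (Finset.univ.filter fun z => p z = g • y).card = (Finset.univ.filter fun z => p z = y).card := by
  symm
  refine Finset.card_bij (fun z _ => g • z) ?_ ?_ ?_
  · intro z hz
    simp only [Finset.mem_filter, Finset.mem_univ, true_and] at hz ⊢
    rw [map_smul, hz]
  · intro z _ w _ h
    exact smul_left_cancel g h
  · intro z hz
    simp only [Finset.mem_filter, Finset.mem_univ, true_and] at hz
    refine ⟨g⁻¹ • z, ?_, smul_inv_smul g z⟩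
    simp [map_smul, hz]

open scoped Classical in
theorem sum_equivariantFiber [Fintype Z] (p : Z →[G] Y) (y : Y) [Fintype (equivariantFiber p y)]
    (F : Z → ℂ) :
    ∑ z : equivariantFiber p y, F z = ∑ z, if p z = y then F z else 0 := by
  rw [← Finset.sum_filter]
  exact (Finset.sum_subtype _ (fun z => by simp [mem_equivariantFiber]) F).symm

/-- The row sums and the column sums of an invariant matrix on a transitive set agree. -/
theorem IsInvariantMatrix.exists_row_col_sum [Fintype Z] [IsPretransitive G Z] {a : Matrix Z Z ℂ}
    (ha : IsInvariantMatrix G a) : ∃ r : ℂ, (∀ x, ∑ w, a x w = r) ∧ ∀ z, ∑ w, a w z = r := by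
  rcases isEmpty_or_nonempty Z with hZ | ⟨⟨z₀⟩⟩
  · exact ⟨0, fun x => hZ.elim x, fun x => hZ.elim x⟩
  have hrow : ∀ x, ∑ w, a x w = ∑ w, a z₀ w := by
    intro x
    obtain ⟨g, rfl⟩ := exists_smul_eq G z₀ x
    rw [← Equiv.sum_comp (MulAction.toPerm g)]
    exact Finset.sum_congr rfl fun w _ => ha g z₀ w
  have hcol : ∀ x, ∑ w, a w x = ∑ w, a w z₀ := by
    intro x
    obtain ⟨g, rfl⟩ := exists_smul_eq G z₀ x
    rw [← Equiv.sum_comp (MulAction.toPerm g)]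
    exact Finset.sum_congr rfl fun w _ => ha g w z₀
  -- The sum of all entries is |Z| times the common row sum and also |Z| times the common column
  -- sum.
  have h := Finset.sum_comm (s := Finset.univ) (t := Finset.univ) (f := fun x w => a x w)
  simp only [hrow, hcol, Finset.sum_const, nsmul_eq_mul] at h
  have hcard : ((Finset.univ : Finset Z).card : ℂ) ≠ 0 := by
    rw [Nat.cast_ne_zero, Finset.card_ne_zero]
    exact ⟨z₀, Finset.mem_univ _⟩
  exact ⟨_, hrow, fun z => (hcol z).trans (mul_left_cancel₀ hcard h).symm⟩

/-- On the support of `a` the pullback sees only one point of the base, so both products have the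
entry `r * b (p x) (p z)`, with `r` the row sum of `a` on one side and its column sum on the other.
-/
theorem blockDiagonal_mul_submatrix_comm [Fintype Z] [IsPretransitive G Z] (p : Z →[G] Y)
    {a : Matrix Z Z ℂ} (b : Matrix Y Y ℂ) (ha : IsInvariantMatrix G a)
    (ha0 : ∀ x z, p x ≠ p z → a x z = 0) :
    a * b.submatrix p p = b.submatrix p p * a := by
  obtain ⟨r, hrow, hcol⟩ := ha.exists_row_col_sum
  ext x z
  rw [Matrix.mul_apply, Matrix.mul_apply]
  trans r * b (p x) (p z)
  · rw [← hrow x, Finset.sum_mul]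
    refine Finset.sum_congr rfl fun w _ => ?_
    by_cases h : p x = p w
    · rw [Matrix.submatrix_apply, h]
    · rw [ha0 _ _ h, zero_mul, zero_mul]
  · rw [← hcol z, Finset.sum_mul]
    refine Finset.sum_congr rfl fun w _ => ?_
    by_cases h : p w = p z
    · rw [Matrix.submatrix_apply, h, mul_comm]
    · rw [ha0 _ _ h, zero_mul, mul_zero]

/-- Summing the pullback of a function along an equivariant map to a transitive set multiplies the
sum by the size of the fibres. -/
theorem exists_sum_comp_eq [Fintype Y] [Fintype Z] [IsPretransitive G Y] (p : Z →[G] Y) :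
    ∃ c : ℂ, ∀ F : Y → ℂ, ∑ z, F (p z) = c * ∑ y, F y := by
  classical
  rcases isEmpty_or_nonempty Y with hY | ⟨⟨y₀⟩⟩
  · have : IsEmpty Z := ⟨fun z => hY.elim (p z)⟩
    exact ⟨1, fun F => by simp⟩
  · refine ⟨(Finset.univ.filter fun z => p z = y₀).card, fun F => ?_⟩
    rw [← Finset.sum_fiberwise Finset.univ p, Finset.mul_sum]
    refine Finset.sum_congr rfl fun y _ => ?_
    obtain ⟨g, rfl⟩ := exists_smul_eq G y₀ y
    rw [← card_equivariantFiber_smul p g y₀, ← nsmul_eq_mul, ← Finset.sum_const]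
    refine Finset.sum_congr rfl fun z hz => ?_
    simp only [Finset.mem_filter] at hz
    rw [hz.2]

open scoped Classical in
/-- An invariant matrix on a fibre extends to a block diagonal invariant matrix. -/
theorem exists_blockDiagonal_extension [IsPretransitive G Y] (p : Z →[G] Y) (y : Y)
    (a : Matrix (equivariantFiber p y) (equivariantFiber p y) ℂ)
    (ha : IsInvariantMatrix (stabilizer G y) a) :
    ∃ A : Matrix Z Z ℂ, IsInvariantMatrix G A ∧ (∀ x z, p x ≠ p z → A x z = 0) ∧
      ∀ x z : equivariantFiber p y, A x z = a x z := by
  choose g hg using fun y' => exists_smul_eq G y' y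
  have hmem : ∀ {y' z}, p z = y' → g y' • z ∈ equivariantFiber p y := by
    intro y' z hz
    rw [mem_equivariantFiber, map_smul, hz, hg]
  let A : Matrix Z Z ℂ := fun x z =>
    if h : p x = p z then a ⟨g (p x) • x, hmem rfl⟩ ⟨g (p x) • z, hmem h.symm⟩ else 0
  -- The chosen transporters play no role: two elements taking `y'` to `y` differ by an element of
  -- the stabiliser of `y`, under which `a` is invariant. Invariance of `A` follows.
  have hA : ∀ (k : G) (y' : Y) (x z : Z) (hx : p x = y') (hz : p z = y') (hk : k • y' = y),
      A x z = a ⟨k • x, by rw [mem_equivariantFiber, map_smul, hx, hk]⟩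
        ⟨k • z, by rw [mem_equivariantFiber, map_smul, hz, hk]⟩ := by
    intro k y' x z hx hz hk
    subst hx
    have hs : k * (g (p x))⁻¹ ∈ stabilizer G y := by
      rw [mem_stabilizer_iff, mul_smul, inv_smul_eq_iff.2 (hg (p x)).symm, hk]
    simp only [A, dif_pos hz.symm]
    rw [← ha ⟨_, hs⟩]
    have hsmul : ∀ w : Z, (k * (g (p x))⁻¹) • g (p x) • w = k • w := fun w => by
      rw [mul_smul, inv_smul_smul]
    congr 1
    · exact Subtype.ext (hsmul x)
    · exact Subtype.ext (hsmul z)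
  refine ⟨A, ?_, fun x z h => dif_neg h, ?_⟩
  · intro k x z
    by_cases h : p x = p z
    · rw [hA (g (p (k • x))) (p (k • x)) (k • x) (k • z) rfl (by rw [map_smul, map_smul, h]) (hg _),
        hA (g (p (k • x)) * k) (p x) x z rfl h.symm (by rw [mul_smul, ← map_smul, hg])]
      simp only [mul_smul]
    · have h' : p (k • x) ≠ p (k • z) := by
        rw [map_smul, map_smul]
        exact fun h' => h (smul_left_cancel k h')
      simp only [A, dif_neg h, dif_neg h']
  · intro x z
    rw [hA 1 y x z x.2 z.2 (one_smul G y)]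
    simp only [one_smul]

/-- The block over `y` of a product of block diagonal matrices is the product of their blocks over
`y`. -/
theorem OrbitalsCommute.equivariantFiber [Fintype Z] [IsPretransitive G Y] (p : Z →[G] Y) (y : Y)
    [Fintype (equivariantFiber p y)] (hc : OrbitalsCommute G Z) :
    OrbitalsCommute (stabilizer G y) (equivariantFiber p y) := by
  classical
  intro a b ha hb
  obtain ⟨A, hA, hA0, hAa⟩ := exists_blockDiagonal_extension p y a ha
  obtain ⟨B, hB, hB0, hBb⟩ := exists_blockDiagonal_extension p y b hb
  ext x z
  have key : ∀ A B : Matrix Z Z ℂ, (∀ x z, p x ≠ p z → A x z = 0) →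
      (A * B) x z = ∑ w : _root_.equivariantFiber p y, A x w * B w z := by
    intro A B hA0
    rw [sum_equivariantFiber p y fun w => A x w * B w z, Matrix.mul_apply]
    refine Finset.sum_congr rfl fun w _ => ?_
    split_ifs with h
    · rfl
    · rw [hA0 _ _ (by rw [x.2]; exact Ne.symm h), zero_mul]
  have h := congrFun (congrFun (hc A B hA hB) x) z
  rw [key A B hA0, key B A hB0] at h
  simp only [hAa, hBb] at h
  simpa only [Matrix.mul_apply] using h

open scoped Classical in
/-- If `G` is transitive on the pairs of points in two given distinct fibres, an invariant matrix is
the sum of a block diagonal one and one pulled back from the base. -/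
theorem IsInvariantMatrix.exists_decomposition (p : Z →[G] Y) (hp : Function.Surjective p)
    (h2 : ∀ x z x' z' : Z, p x = p x' → p z = p z' → p x ≠ p z →
      ∃ g : G, g • x = x' ∧ g • z = z')
    {a : Matrix Z Z ℂ} (ha : IsInvariantMatrix G a) :
    ∃ (a₀ : Matrix Z Z ℂ) (a₁ : Matrix Y Y ℂ), IsInvariantMatrix G a₀ ∧ IsInvariantMatrix G a₁ ∧
      (∀ x z, p x ≠ p z → a₀ x z = 0) ∧ a = a₀ + a₁.submatrix p p := by
  choose s hs using hp
  -- With 0 on the diagonal, the diagonal blocks of `a` go entirely into `a₀`. Off the diagonal,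
  -- `h2` makes the value independent of the section `s`.
  let a₁ : Matrix Y Y ℂ := fun y y' => if y = y' then 0 else a (s y) (s y')
  have ha₁ : IsInvariantMatrix G a₁ := by
    intro g y y'
    simp only [a₁, smul_left_cancel_iff]
    split_ifs with h
    · rfl
    · obtain ⟨k, hk, hk'⟩ := h2 (g • s y) (g • s y') (s (g • y)) (s (g • y'))
        (by rw [map_smul, hs, hs]) (by rw [map_smul, hs, hs])
        (by rw [map_smul, map_smul, hs, hs]; exact fun h' => h (smul_left_cancel g h'))
      rw [← hk, ← hk', ha k, ha g]
  refine ⟨a - a₁.submatrix p p, a₁, ?_, ha₁, ?_, by rw [sub_add_cancel]⟩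
  · intro g x z
    rw [Matrix.sub_apply, Matrix.sub_apply, ha g, ha₁.submatrix p g]
  · intro x z h
    obtain ⟨k, hk, hk'⟩ := h2 x z (s (p x)) (s (p z)) (hs _).symm (hs _).symm h
    rw [Matrix.sub_apply, Matrix.submatrix_apply]
    simp only [a₁, if_neg h]
    rw [← hk, ← hk', ha k, sub_self]

theorem blockDiagonal_mul_comm [Fintype Z] (p : Z →[G] Y) [∀ y, Fintype (equivariantFiber p y)]
    (hF : ∀ y, OrbitalsCommute (stabilizer G y) (equivariantFiber p y)) {a b : Matrix Z Z ℂ}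
    (ha : IsInvariantMatrix G a) (hb : IsInvariantMatrix G b)
    (ha0 : ∀ x z, p x ≠ p z → a x z = 0) (hb0 : ∀ x z, p x ≠ p z → b x z = 0) :
    a * b = b * a := by
  classical
  ext x z
  have key : ∀ a b : Matrix Z Z ℂ, (∀ x z, p x ≠ p z → a x z = 0) →
      (a * b) x z = ∑ w : equivariantFiber p (p x), a x w * b w z := by
    intro a b ha0
    rw [sum_equivariantFiber p (p x) fun w => a x w * b w z, Matrix.mul_apply]
    refine Finset.sum_congr rfl fun w _ => ?_
    split_ifs with h
    · rfl
    · rw [ha0 _ _ (Ne.symm h), zero_mul]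
  rw [key a b ha0, key b a hb0]
  by_cases h : p x = p z
  · have hres : ∀ c : Matrix Z Z ℂ, IsInvariantMatrix G c →
        IsInvariantMatrix (stabilizer G (p x)) (Y := equivariantFiber p (p x))
          (c.submatrix Subtype.val Subtype.val) := fun c hc g u v => hc g.1 u v
    exact congrFun (congrFun (hF (p x) _ _ (hres a ha) (hres b hb)) ⟨x, rfl⟩) ⟨z, h.symm⟩
  · rw [Finset.sum_eq_zero, Finset.sum_eq_zero]
    · rintro ⟨w, hw⟩ -
      rw [ha0 w z (by rw [mem_equivariantFiber.1 hw]; exact h), mul_zero]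
    · rintro ⟨w, hw⟩ -
      rw [hb0 w z (by rw [mem_equivariantFiber.1 hw]; exact h), mul_zero]

theorem OrbitalsCommute.of_base_of_fibers [Fintype Y] [Fintype Z] [IsPretransitive G Y]
    [IsPretransitive G Z]
    (p : Z →[G] Y) (hp : Function.Surjective p)
    (h2 : ∀ x z x' z' : Z, p x = p x' → p z = p z' → p x ≠ p z →
      ∃ g : G, g • x = x' ∧ g • z = z')
    [∀ y, Fintype (_root_.equivariantFiber p y)] (hY : OrbitalsCommute G Y)
    (hF : ∀ y, OrbitalsCommute (stabilizer G y) (_root_.equivariantFiber p y)) :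
    OrbitalsCommute G Z := by
  intro a b ha hb
  obtain ⟨a₀, a₁, ha₀, ha₁, ha0, rfl⟩ := ha.exists_decomposition p hp h2
  obtain ⟨b₀, b₁, hb₀, hb₁, hb0, rfl⟩ := hb.exists_decomposition p hp h2
  have hpull : a₁.submatrix p p * b₁.submatrix p p = b₁.submatrix p p * a₁.submatrix p p := by
    obtain ⟨c, hsum⟩ := exists_sum_comp_eq p
    ext x z
    have h := congrFun (congrFun (hY a₁ b₁ ha₁ hb₁) (p x)) (p z)
    simp only [Matrix.mul_apply, Matrix.submatrix_apply] at h ⊢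
    -- The product of two pullbacks is the fibre size `c` times the pullback of the product.
    rw [hsum fun y => a₁ (p x) y * b₁ y (p z), hsum fun y => b₁ (p x) y * a₁ y (p z), h]
  rw [add_mul, add_mul, mul_add, mul_add, mul_add, mul_add,
    blockDiagonal_mul_comm p hF ha₀ hb₀ ha0 hb0, blockDiagonal_mul_submatrix_comm p b₁ ha₀ ha0,
    ← blockDiagonal_mul_submatrix_comm p a₁ hb₀ hb0, hpull]
  abel

end Orbitals

/-! ### Multiplicity and commutativity of the endomorphism algebra -/

section Multiplicity

open Representation

variable {H V W : Type*} [Group H] [AddCommGroup V] [Module ℂ V] [AddCommGroup W] [Module ℂ W]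

theorem repMultiplicity_le_one_iff (π : Representation ℂ H V) (ρ : Representation ℂ H W) :
    repMultiplicity π ρ ≤ 1 ↔
      ∀ φ ψ : IntertwiningMap π ρ, φ ≠ 0 → ∃ c : ℂ, ψ = c • φ := by
  rw [repMultiplicity, rank_le_one_iff]
  constructor
  · rintro ⟨v, hv⟩ φ ψ hφ
    obtain ⟨r, rfl⟩ := hv φ
    obtain ⟨s, rfl⟩ := hv ψ
    have hr : r ≠ 0 := by
      rintro rfl
      exact hφ (zero_smul _ _)
    exact ⟨s * r⁻¹, by rw [smul_smul, inv_mul_cancel_right₀ hr]⟩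
  · intro h
    by_cases h0 : ∃ φ : IntertwiningMap π ρ, φ ≠ 0
    · obtain ⟨φ, hφ⟩ := h0
      refine ⟨φ, fun ψ => ?_⟩
      obtain ⟨c, hc⟩ := h φ ψ hφ
      exact ⟨c, hc.symm⟩
    · push Not at h0
      exact ⟨0, fun ψ => ⟨0, by rw [h0 ψ, smul_zero]⟩⟩

/-- A subrepresentation of an irreducible representation with a nonzero vector is everything. -/
theorem Representation.IsIrreducible.mem_of_mem {π : Representation ℂ H V} (hπ : π.IsIrreducible)
    (U : Subrepresentation π) {v : V} (hv : v ≠ 0) (hvU : v ∈ U.toSubmodule) (w : V) :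
    w ∈ U.toSubmodule := by
  rcases hπ.eq_bot_or_eq_top U with h | h
  · rw [h] at hvU
    exact absurd ((Submodule.mem_bot ℂ).1 hvU) hv
  · rw [h]
    exact Submodule.mem_top

theorem Representation.IsIrreducible.exists_ne_zero {π : Representation ℂ H V}
    (hπ : π.IsIrreducible) : ∃ v : V, v ≠ 0 := by
  by_contra! h
  refine bot_ne_top (α := Subrepresentation π) (Subrepresentation.ext ?_)
  ext v
  rw [h v]
  exact ⟨fun _ => Submodule.zero_mem _, fun _ => Submodule.zero_mem _⟩

/-- An equivariant map with values in the image of an equivariant injection factors through it. -/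
theorem exists_comp_eq_of_forall_mem_range {U : Type*} [AddCommGroup U] [Module ℂ U]
    {σ : Representation ℂ H U} {π : Representation ℂ H V} {ρ : Representation ℂ H W}
    (ι : IntertwiningMap σ ρ) (hι : Function.Injective ι) (φ : IntertwiningMap π ρ)
    (h : ∀ v, ∃ x, ι x = φ v) : ∃ φ' : IntertwiningMap π σ, ι.comp φ' = φ := by
  choose f hf using h
  refine ⟨⟨⟨⟨f, fun v w => hι ?_⟩, fun c v => hι ?_⟩, fun g => LinearMap.ext fun v => hι ?_⟩, ?_⟩
  · rw [hf, map_add, map_add, hf, hf]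
  · rw [hf, map_smul, map_smul, hf]; rfl
  · change ι (f (π g v)) = ι (σ g (f v))
    rw [hf, ι.isIntertwining, hf, φ.isIntertwining]
  · ext v
    exact hf v

/-- Schur's lemma. -/
theorem Representation.IsIrreducible.exists_eq_smul [FiniteDimensional ℂ V]
    {π : Representation ℂ H V} (hπ : π.IsIrreducible) (f : IntertwiningMap π π) :
    ∃ c : ℂ, f = c • IntertwiningMap.id π := by
  obtain ⟨c, hc⟩ := (IsIrreducible.algebraMap_intertwiningMap_bijective_of_isAlgClosed
    (k := ℂ) (ρ := π)).2 f
  exact ⟨c, hc.symm⟩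

/-- In a semisimple representation, an equivariant injection has an equivariant retraction. -/
theorem exists_retraction {π : Representation ℂ H V} {ρ : Representation ℂ H W}
    [ComplementedLattice (Subrepresentation ρ)] (φ : IntertwiningMap π ρ)
    (hφ : Function.Injective φ) :
    ∃ P : IntertwiningMap ρ π, P.comp φ = IntertwiningMap.id π := by
  obtain ⟨T, hT⟩ := exists_isCompl φ.range
  have hex : ∀ w : W, ∃ v : V, w - φ v ∈ T.toSubmodule := by
    intro w
    have hw : w ∈ (φ.range ⊔ T).toSubmodule := by
      rw [hT.sup_eq_top]
      exact Submodule.mem_top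
    obtain ⟨x, hx, y, hy, rfl⟩ := Submodule.mem_sup.1 hw
    obtain ⟨v, rfl⟩ := hx
    refine ⟨v, ?_⟩
    rw [show (φ.toLinearMap v : W) = φ v from rfl, add_sub_cancel_left]
    exact hy
  have huniq : ∀ v : V, φ v ∈ T.toSubmodule → v = 0 := by
    intro v hv
    have : φ v ∈ (φ.range ⊓ T).toSubmodule := ⟨⟨v, rfl⟩, hv⟩
    rw [hT.inf_eq_bot] at this
    exact hφ (((Submodule.mem_bot ℂ).1 this).trans (map_zero φ).symm)
  choose P hP using hex
  -- `P w` is characterised by `w - φ (P w) ∈ T`, so linearity and equivariance of `P` reduce to the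
  -- closure properties of `T`.
  have hchar : ∀ w v, w - φ v ∈ T.toSubmodule → P w = v := by
    intro w v h
    refine sub_eq_zero.1 (huniq _ ?_)
    have := T.toSubmodule.sub_mem h (hP w)
    rwa [sub_sub_sub_cancel_left, ← map_sub] at this
  refine ⟨⟨⟨⟨P, fun w w' => hchar _ _ ?_⟩, fun c w => hchar _ _ ?_⟩,
    fun g => LinearMap.ext fun w => hchar _ _ ?_⟩, ?_⟩
  · rw [map_add, add_sub_add_comm]
    exact T.toSubmodule.add_mem (hP w) (hP w')
  · rw [map_smul, RingHom.id_apply, ← smul_sub]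
    exact T.toSubmodule.smul_mem c (hP w)
  · change ρ g w - φ (π g (P w)) ∈ _
    rw [φ.isIntertwining, ← map_sub]
    exact T.apply_mem_toSubmodule g (hP w)
  · ext v
    exact hchar (φ v) v (by rw [sub_self]; exact Submodule.zero_mem _)

/-- Let `P` be a retraction of `φ`; by Schur's lemma `P ∘ ψ` is a scalar `c`. Evaluating the
commutation of `ψ ∘ P` and `φ ∘ P` at `φ v` gives `ψ v = c • φ v`. -/
theorem repMultiplicity_le_one_of_commute [FiniteDimensional ℂ W] {ρ : Representation ℂ H W}
    [ComplementedLattice (Subrepresentation ρ)]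
    (hc : ∀ A B : IntertwiningMap ρ ρ, A * B = B * A) {π : Representation ℂ H V}
    (hπ : π.IsIrreducible) : repMultiplicity π ρ ≤ 1 := by
  rw [repMultiplicity_le_one_iff]
  intro φ ψ hφ
  have hinj : Function.Injective φ := (IsIrreducible.injective_or_eq_zero φ).resolve_right hφ
  have : FiniteDimensional ℂ V := FiniteDimensional.of_injective φ.toLinearMap hinj
  obtain ⟨P, hP⟩ := exists_retraction φ hinj
  obtain ⟨c, hPψ⟩ := hπ.exists_eq_smul (P.comp ψ)
  refine ⟨c, IntertwiningMap.ext (LinearMap.ext fun v => ?_)⟩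
  have hPv : P (φ v) = v := congrArg (fun f : IntertwiningMap π π => f v) hP
  have hPψv : P (ψ v) = c • v := congrArg (fun f : IntertwiningMap π π => f v) hPψ
  have h := congrArg (fun f : IntertwiningMap ρ ρ => f (φ v)) (hc (ψ.comp P) (φ.comp P))
  change ψ (P (φ (P (φ v)))) = φ (P (ψ (P (φ v)))) at h
  rw [hPv, hPv, hPψv, map_smul] at h
  exact h

theorem exists_isAtom_le [FiniteDimensional ℂ W] {ρ : Representation ℂ H W}
    (C : Subrepresentation ρ) (hC : C ≠ ⊥) : ∃ S ≤ C, IsAtom S := by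
  have hwf : WellFounded ((· < ·) : Subrepresentation ρ → Subrepresentation ρ → Prop) :=
    Subrelation.wf (r := InvImage (· < ·) fun S : Subrepresentation ρ => S.toSubmodule)
      (fun h => h) (InvImage.wf _ wellFounded_lt)
  obtain ⟨S, ⟨hS, hSC⟩, hmin⟩ := hwf.has_min {S | S ≠ ⊥ ∧ S ≤ C} ⟨C, hC, le_rfl⟩
  refine ⟨S, hSC, hS, fun T hT => ?_⟩
  by_contra hne
  exact hmin T ⟨hne, hT.le.trans hSC⟩ hT

/-- A minimal subrepresentation is the image of an irreducible representation on some `ℂᵈ`. -/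
theorem IsAtom.exists_irreducible [FiniteDimensional ℂ W] {ρ : Representation ℂ H W}
    {S : Subrepresentation ρ} (hS : IsAtom S) :
    ∃ (d : ℕ) (π : Representation ℂ H (Fin d → ℂ)) (φ : IntertwiningMap π ρ),
      π.IsIrreducible ∧ Function.Injective φ ∧ φ.range = S := by
  -- Coordinates move `S` to a space in `Type`, where `IsMultiplicityFree` tests.
  let e : S.toSubmodule ≃ₗ[ℂ] (Fin (Module.finrank ℂ S.toSubmodule) → ℂ) :=
    LinearEquiv.ofFinrankEq _ _ (by simp)
  let π : Representation ℂ H (Fin (Module.finrank ℂ S.toSubmodule) → ℂ) :=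
    { toFun := fun h => e.toLinearMap ∘ₗ S.toRepresentation h ∘ₗ e.symm.toLinearMap
      map_one' := by ext; simp
      map_mul' := fun a b => LinearMap.ext fun v => by simp }
  let φ : IntertwiningMap π ρ :=
    ⟨S.toSubmodule.subtype ∘ₗ e.symm.toLinearMap, fun g => LinearMap.ext fun v => by
      change ((e.symm (e (S.toRepresentation g (e.symm v))) : S.toSubmodule) : W) = _
      rw [e.symm_apply_apply]
      rfl⟩
  have hφ : Function.Injective φ := Subtype.val_injective.comp e.symm.injective
  have hrange : φ.range = S := by
    refine Subrepresentation.ext (Submodule.ext fun w => ⟨?_, fun hw => ?_⟩)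
    · rintro ⟨v, rfl⟩
      exact (e.symm v).2
    · exact ⟨e ⟨w, hw⟩, congrArg Subtype.val (e.symm_apply_apply _)⟩
  refine ⟨_, π, φ, ?_, hφ, hrange⟩
  have hbt : ∀ U : Subrepresentation π, U = ⊥ ∨ U = ⊤ := by
    intro U
    let U' : Subrepresentation ρ := ⟨U.toSubmodule.map φ.toLinearMap, by
      rintro g _ ⟨v, hv, rfl⟩
      exact ⟨π g v, U.apply_mem_toSubmodule g hv, IntertwiningMap.isIntertwining _ _ φ g v⟩⟩
    have hle : U' ≤ S := by
      rw [← hrange]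
      rintro _ ⟨v, -, rfl⟩
      exact ⟨v, rfl⟩
    rcases hS.le_iff.1 hle with h | h
    · left
      refine Subrepresentation.ext (Submodule.ext fun v => ⟨fun hv => ?_, fun hv => ?_⟩)
      · have : φ v ∈ U'.toSubmodule := ⟨v, hv, rfl⟩
        rw [h] at this
        exact hφ (((Submodule.mem_bot ℂ).1 this).trans (map_zero φ).symm)
      · rw [show v = 0 from (Submodule.mem_bot ℂ).1 hv]
        exact Submodule.zero_mem _
    · right
      refine Subrepresentation.ext (Submodule.ext fun v => ⟨fun _ => Submodule.mem_top, fun _ => ?_⟩)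
      have : φ v ∈ U'.toSubmodule := by
        exact (hrange.trans h.symm).le ⟨v, rfl⟩
      obtain ⟨v', hv', hvv⟩ := this
      rwa [← hφ hvv]
  have hne : (⊥ : Subrepresentation π) ≠ ⊤ := by
    intro h
    refine hS.1 (Subrepresentation.ext (Submodule.ext fun w => ⟨fun hw => ?_, fun hw => ?_⟩))
    · rw [← hrange] at hw
      obtain ⟨v, rfl⟩ := hw
      have hv : v ∈ (⊤ : Subrepresentation π).toSubmodule := Submodule.mem_top
      rw [← h] at hv
      rw [show v = 0 from (Submodule.mem_bot ℂ).1 hv, map_zero]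
      exact Submodule.zero_mem _
    · rw [show w = 0 from (Submodule.mem_bot ℂ).1 hw]
      exact Submodule.zero_mem _
  have : Nontrivial (Subrepresentation π) := ⟨⟨_, _, hne⟩⟩
  exact ⟨hbt⟩

/-- In a multiplicity-free semisimple representation, all equivariant endomorphisms commute. -/
theorem commute_of_repMultiplicity_le_one [FiniteDimensional ℂ W] {ρ : Representation ℂ H W}
    [ComplementedLattice (Subrepresentation ρ)]
    (h : ∀ (d : ℕ) (π : Representation ℂ H (Fin d → ℂ)) (φ : IntertwiningMap π ρ),
      π.IsIrreducible → Function.Injective φ → repMultiplicity π ρ ≤ 1)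
    (A B : IntertwiningMap ρ ρ) : A * B = B * A := by
  -- Multiplicity one forces `A` and `B` to act by scalars on each irreducible subrepresentation, so
  -- a minimal one inside `C` would lie in the kernel of the commutator.
  obtain ⟨C, hC⟩ := exists_isCompl (A * B - B * A).ker
  have hCbot : C = ⊥ := by
    by_contra hne
    obtain ⟨S, hSC, hS⟩ := exists_isAtom_le C hne
    obtain ⟨d, π, φ, hπ, hφ, rfl⟩ := hS.exists_irreducible
    obtain ⟨v, hv⟩ := hπ.exists_ne_zero
    have hφ0 : φ ≠ 0 := by
      rintro rfl
      exact hv (hφ rfl)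
    have hm := (repMultiplicity_le_one_iff π ρ).1 (h d π φ hπ hφ)
    obtain ⟨a, ha⟩ := hm φ (A.comp φ) hφ0
    obtain ⟨b, hb⟩ := hm φ (B.comp φ) hφ0
    have ha' : ∀ v, A (φ v) = a • φ v := fun v =>
      congrArg (fun f : IntertwiningMap π ρ => f v) ha
    have hb' : ∀ v, B (φ v) = b • φ v := fun v =>
      congrArg (fun f : IntertwiningMap π ρ => f v) hb
    have hker : φ v ∈ (A * B - B * A).ker.toSubmodule := by
      change A (B (φ v)) - B (A (φ v)) = 0
      rw [ha', hb', map_smul, map_smul, ha', hb', smul_comm, sub_self]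
    have : φ v ∈ ((A * B - B * A).ker ⊓ C).toSubmodule := ⟨hker, hSC ⟨v, rfl⟩⟩
    rw [hC.inf_eq_bot] at this
    exact hv (hφ (((Submodule.mem_bot ℂ).1 this).trans (map_zero φ).symm))
  rw [hCbot] at hC
  have htop := eq_top_of_isCompl_bot hC
  refine IntertwiningMap.ext (LinearMap.ext fun w => sub_eq_zero.1 ?_)
  have hw : w ∈ (A * B - B * A).ker.toSubmodule := by
    rw [htop]
    exact Submodule.mem_top
  exact hw

end Multiplicity

/-! ### Permutation representations -/

section Permutation

open Representation

/-- The representation on the functions on an `H`-set. -/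
def functionRep (H Y : Type*) [Group H] [MulAction H Y] : Representation ℂ H (Y → ℂ) where
  toFun h :=
    { toFun := fun f y => f (h⁻¹ • y)
      map_add' := fun _ _ => rfl
      map_smul' := fun _ _ => rfl }
  map_one' := by
    refine LinearMap.ext fun f => funext fun x => ?_
    change f ((1 : H)⁻¹ • x) = f x
    rw [inv_one, one_smul]
  map_mul' a b := by
    refine LinearMap.ext fun f => funext fun x => ?_
    change f ((a * b)⁻¹ • x) = f (b⁻¹ • a⁻¹ • x)
    rw [mul_inv_rev, mul_smul]

variable {H Y : Type*} [Group H] [MulAction H Y]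

theorem functionRep_apply (h : H) (f : Y → ℂ) (y : Y) : functionRep H Y h f y = f (h⁻¹ • y) := rfl

theorem functionRep_single [DecidableEq Y] (h : H) (y : Y) (c : ℂ) :
    functionRep H Y h (Pi.single y c) = Pi.single (h • y) c := by
  funext x
  simp only [functionRep_apply, Pi.single_apply, inv_smul_eq_iff]

variable [Fintype Y]

/-- Permutations of the coordinates preserve the standard inner product, so orthogonal complements
of subrepresentations are invariant. -/
instance : ComplementedLattice (Subrepresentation (functionRep H Y)) where
  exists_isCompl S := by
    let e := WithLp.linearEquiv 2 ℂ (Y → ℂ)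
    let S' : Submodule ℂ (EuclideanSpace ℂ Y) := S.toSubmodule.comap e.toLinearMap
    let T : Subrepresentation (functionRep H Y) := ⟨S'ᗮ.comap e.symm.toLinearMap, by
      intro g v hv
      rw [Submodule.mem_comap, Submodule.mem_orthogonal] at hv ⊢
      intro u hu
      have := hv (e.symm (functionRep H Y g⁻¹ (e u))) (by
        rw [Submodule.mem_comap]
        exact S.apply_mem_toSubmodule g⁻¹ hu)
      rw [← this]
      simp only [PiLp.inner_apply]
      rw [← Equiv.sum_comp (MulAction.toPerm g)]
      refine Finset.sum_congr rfl fun y _ => ?_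
      change inner ℂ (u (g • y)) (v (g⁻¹ • g • y)) = inner ℂ (u (g⁻¹⁻¹ • y)) (v y)
      rw [inv_inv, inv_smul_smul]⟩
    have hcompl := S'.isCompl_orthogonal
    refine ⟨T, IsCompl.of_eq ?_ ?_⟩
    · refine Subrepresentation.ext (Submodule.ext fun v => ⟨fun hv => ?_, fun hv => ?_⟩)
      · have : e.symm v ∈ S' ⊓ S'ᗮ := ⟨hv.1, hv.2⟩
        rw [hcompl.inf_eq_bot] at this
        exact (LinearEquiv.map_eq_zero_iff e.symm).1 ((Submodule.mem_bot ℂ).1 this)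
      · rw [show v = 0 from (Submodule.mem_bot ℂ).1 hv]
        exact Submodule.zero_mem _
    · refine Subrepresentation.ext (Submodule.ext fun v => ⟨fun _ => Submodule.mem_top, fun _ => ?_⟩)
      have : e.symm v ∈ S' ⊔ S'ᗮ := by
        rw [hcompl.sup_eq_top]
        exact Submodule.mem_top
      obtain ⟨x, hx, y, hy, hxy⟩ := Submodule.mem_sup.1 this
      refine Submodule.mem_sup.2 ⟨e x, hx, e y, hy, ?_⟩
      rw [← map_add, hxy, e.apply_symm_apply]

/-- Invariant matrices are the same as equivariant endomorphisms of the function space. -/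
theorem orbitalsCommute_iff : OrbitalsCommute H Y ↔
    ∀ A B : IntertwiningMap (functionRep H Y) (functionRep H Y), A * B = B * A := by
  classical
  constructor
  · intro hc A B
    have key : ∀ A : IntertwiningMap (functionRep H Y) (functionRep H Y),
        IsInvariantMatrix H (LinearMap.toMatrix' A.toLinearMap) := by
      intro A h x y
      have := congrFun (IntertwiningMap.isIntertwining _ _ A h (Pi.single y 1)) (h • x)
      rw [functionRep_single, functionRep_apply, inv_smul_smul] at this
      rw [LinearMap.toMatrix'_apply, LinearMap.toMatrix'_apply]
      exact this
    have h := hc _ _ (key A) (key B)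
    rw [← LinearMap.toMatrix'_mul, ← LinearMap.toMatrix'_mul] at h
    exact IntertwiningMap.ext (LinearMap.toMatrix'.injective h)
  · intro hc a b ha hb
    have key : ∀ a : Matrix Y Y ℂ, IsInvariantMatrix H a → ∀ g,
        Matrix.toLin' a ∘ₗ functionRep H Y g = functionRep H Y g ∘ₗ Matrix.toLin' a := by
      intro a ha g
      refine LinearMap.ext fun f => funext fun x => ?_
      simp only [LinearMap.comp_apply, functionRep_apply, Matrix.toLin'_apply, Matrix.mulVec,
        dotProduct]
      rw [← Equiv.sum_comp (MulAction.toPerm g)]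
      refine Finset.sum_congr rfl fun y _ => ?_
      rw [MulAction.toPerm_apply, inv_smul_smul, ← ha g (g⁻¹ • x) y, smul_inv_smul]
    have h := congrArg IntertwiningMap.toLinearMap (hc ⟨_, key a ha⟩ ⟨_, key b hb⟩)
    apply Matrix.toLin'.injective
    rw [Matrix.toLin'_mul, Matrix.toLin'_mul]
    exact h

end Permutation

/-! ### A criterion for Gelfand pairs -/

section Criterion

open Representation

variable {H : Type u} [Group H] [TopologicalSpace H] [IsTopologicalGroup H]

theorem isSmoothRep_functionRep {N : Subgroup H} (hN : IsOpen (N : Set H)) [Finite (H ⧸ N)] :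
    IsSmoothRep (functionRep H (H ⧸ N)) := by
  have := QuotientGroup.discreteTopology hN
  intro f
  have : {h : H | functionRep H (H ⧸ N) h f = f} =
      ⋂ y : H ⧸ N, (fun h : H => h⁻¹ • y) ⁻¹' {x | f x = f y} := by
    ext h
    simp only [Set.mem_ofPred_eq, funext_iff, functionRep_apply, Set.mem_iInter, Set.mem_preimage]
  rw [this]
  exact isOpen_iInter_of_finite fun y =>
    (isOpen_discrete _).preimage (continuous_inv.smul continuous_const)

/-- Functions on `H ⧸ N` with `N` an open subgroup are locally constant functions on `H ⧸ K`. -/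
noncomputable def pullbackFunction {K N : Subgroup H} (h : K ≤ N) (hN : IsOpen (N : Set H)) :
    IntertwiningMap (functionRep H (H ⧸ N)) (cosetRep K) where
  toFun f := ⟨fun x => f (Subgroup.quotientMapOfLE h x), by
    have := QuotientGroup.discreteTopology hN
    exact (IsLocallyConstant.of_discrete f).comp_continuous (continuous_quot_lift _ continuous_quot_mk)⟩
  map_add' _ _ := rfl
  map_smul' _ _ := rfl
  isIntertwining' g := by
    refine LinearMap.ext fun f => LocallyConstant.ext fun x => ?_
    induction x using QuotientGroup.induction_on
    rfl

theorem pullbackFunction_injective {K N : Subgroup H} (h : K ≤ N) (hN : IsOpen (N : Set H)) :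
    Function.Injective (pullbackFunction h hN) := by
  intro f f' hff
  funext x
  induction x using QuotientGroup.induction_on with
  | H g => exact congrArg (fun F : LocallyConstant (H ⧸ K) ℂ => F (g : H ⧸ K)) hff

theorem exists_pullbackFunction_eq {K N : Subgroup H} (h : K ≤ N) (hN : IsOpen (N : Set H))
    (f : LocallyConstant (H ⧸ K) ℂ)
    (hf : ∀ g : H, ∀ k ∈ N, f ((g * k : H) : H ⧸ K) = f (g : H ⧸ K)) :
    ∃ f', pullbackFunction h hN f' = f := by
  refine ⟨fun x => Quotient.liftOn' x (fun g : H => f (g : H ⧸ K)) ?_, ?_⟩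
  · intro a b hab
    rw [QuotientGroup.leftRel_apply] at hab
    have := hf a _ hab
    rw [mul_inv_cancel_left] at this
    exact this.symm
  · refine LocallyConstant.ext fun x => ?_
    induction x using QuotientGroup.induction_on
    rfl

/-- If every locally constant function on `H ⧸ K` factors through one of the finite quotients
`H ⧸ N n` for a decreasing sequence of open subgroups `N n`, the Gelfand property of `(H, K)` can be
read off from the orbital matrices of these quotients. -/
theorem isGelfandPair_iff_forall_orbitalsCommute {K : Subgroup H} (N : ℕ → Subgroup H)
    (hanti : Antitone N) (hKN : ∀ n, K ≤ N n) (hopen : ∀ n, IsOpen (N n : Set H))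
    [∀ n, Fintype (H ⧸ N n)]
    (hfac : ∀ f : LocallyConstant (H ⧸ K) ℂ, ∃ n, ∀ g : H, ∀ k ∈ N n,
      f ((g * k : H) : H ⧸ K) = f (g : H ⧸ K)) :
    IsGelfandPair K ↔ ∀ n, OrbitalsCommute H (H ⧸ N n) := by
  constructor
  · intro hG n
    rw [orbitalsCommute_iff]
    refine commute_of_repMultiplicity_le_one fun d π φ hπ hφ => ?_
    have hsmooth : IsSmoothRep π := by
      intro w
      convert isSmoothRep_functionRep (hopen n) (φ w) using 1
      ext h
      rw [Set.mem_ofPred_eq, Set.mem_ofPred_eq, ← φ.isIntertwining, hφ.eq_iff]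
    have hm := (repMultiplicity_le_one_iff _ _).1 (hG _ π hπ hsmooth)
    have hι := pullbackFunction_injective (hKN n) (hopen n)
    rw [repMultiplicity_le_one_iff]
    intro φ₁ ψ hφ₁
    obtain ⟨c, hc⟩ := hm ((pullbackFunction (hKN n) (hopen n)).comp φ₁)
      ((pullbackFunction (hKN n) (hopen n)).comp ψ) (by
        intro h
        refine hφ₁ (IntertwiningMap.ext (LinearMap.ext fun v => hι ?_))
        rw [show pullbackFunction (hKN n) (hopen n) (φ₁.toLinearMap v) = 0 from
          congrArg (fun F : IntertwiningMap π (cosetRep K) => F v) h]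
        exact (map_zero _).symm)
    refine ⟨c, IntertwiningMap.ext (LinearMap.ext fun v => hι ?_)⟩
    change _ = pullbackFunction (hKN n) (hopen n) (c • φ₁ v)
    rw [map_smul]
    exact congrArg (fun F : IntertwiningMap π (cosetRep K) => F v) hc
  · intro hc V _ _ π hπ _
    rw [repMultiplicity_le_one_iff]
    intro φ ψ hφ
    -- A nonzero `v` generates `π`, so once `φ v` and `ψ v` come from a common `H ⧸ N n`, all of `φ`
    -- and `ψ` do.
    obtain ⟨v, hv⟩ := hπ.exists_ne_zero
    obtain ⟨n₁, hn₁⟩ := hfac (φ v)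
    obtain ⟨n₂, hn₂⟩ := hfac (ψ v)
    let n := max n₁ n₂
    let ι := pullbackFunction (hKN n) (hopen n)
    have hι := pullbackFunction_injective (hKN n) (hopen n)
    have hlift : ∀ χ : IntertwiningMap π (cosetRep K), (∃ f, ι f = χ v) →
        ∃ χ' : IntertwiningMap π (functionRep H (H ⧸ N n)), ι.comp χ' = χ := by
      rintro χ ⟨f, hf⟩
      refine exists_comp_eq_of_forall_mem_range ι hι χ fun w => ?_
      let U : Subrepresentation π := ⟨ι.range.toSubmodule.comap χ.toLinearMap, by
        intro g w hw
        rw [Submodule.mem_comap] at hw ⊢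
        rw [show χ.toLinearMap (π g w) = cosetRep K g (χ w) from
          IntertwiningMap.isIntertwining _ _ χ g w]
        exact ι.range.apply_mem_toSubmodule g hw⟩
      exact hπ.mem_of_mem U hv ⟨f, hf⟩ w
    obtain ⟨φ', rfl⟩ := hlift φ (exists_pullbackFunction_eq _ _ _ fun g k hk =>
      hn₁ g k (hanti (le_max_left _ _) hk))
    obtain ⟨ψ', rfl⟩ := hlift ψ (exists_pullbackFunction_eq _ _ _ fun g k hk =>
      hn₂ g k (hanti (le_max_right _ _) hk))
    have hm := repMultiplicity_le_one_of_commute (orbitalsCommute_iff.1 (hc n)) hπ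
    obtain ⟨c, rfl⟩ := (repMultiplicity_le_one_iff _ _).1 hm φ' ψ' (by
      rintro rfl
      exact hφ (IntertwiningMap.ext (LinearMap.ext fun w => map_zero ι)))
    exact ⟨c, IntertwiningMap.comp_smul _ _ _ c ι φ'⟩

theorem isGelfandPair_iff_orbitalsCommute {K : Subgroup H} (hK : IsOpen (K : Set H))
    [Fintype (H ⧸ K)] : IsGelfandPair K ↔ OrbitalsCommute H (H ⧸ K) := by
  rw [isGelfandPair_iff_forall_orbitalsCommute (fun _ => K) antitone_const (fun _ => le_rfl)
    (fun _ => hK)]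
  · exact forall_const ℕ
  · refine fun f => ⟨0, fun g k hk => ?_⟩
    rw [QuotientGroup.mk_mul_of_mem g hk]

end Criterion

/-! ### Coset spaces and transitive actions -/

section Cosets

open MulAction

/-- A transitive action is isomorphic to the action on the cosets of a point stabiliser, up to an
identification of the acting groups. -/
theorem exists_quotient_equiv {H H' F : Type*} [Group H] [Group H'] [MulAction H' F]
    [IsPretransitive H' F] (θ : H ≃* H') (K : Subgroup H) (y : F)
    (hK : ∀ h, h ∈ K ↔ θ h • y = y) :
    ∃ e : H ⧸ K ≃ F, ∀ (h : H) (x : H ⧸ K), e (h • x) = θ h • e x := by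
  have hlift : ∀ a b : H, (a : H ⧸ K) = b ↔ θ a • y = θ b • y := by
    intro a b
    rw [QuotientGroup.eq, hK, map_mul, map_inv, mul_smul, inv_smul_eq_iff, eq_comm]
  let f : H ⧸ K → F := Quotient.lift (fun h : H => θ h • y) fun a b hab =>
    (hlift a b).1 (Quotient.sound hab)
  refine ⟨Equiv.ofBijective f ⟨?_, ?_⟩, ?_⟩
  · intro x x' h
    induction x using QuotientGroup.induction_on
    induction x' using QuotientGroup.induction_on
    exact (hlift _ _).2 h
  · intro z
    obtain ⟨g, rfl⟩ := exists_smul_eq H' y z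
    refine ⟨(θ.symm g : H), ?_⟩
    change θ (θ.symm g) • y = g • y
    rw [θ.apply_symm_apply]
  · intro h x
    induction x using QuotientGroup.induction_on with
    | H a =>
      change θ (h * a) • y = θ h • θ a • y
      rw [map_mul, mul_smul]

theorem orbitalsCommute_iff_of_equiv {H H' Y F : Type*} [Group H] [Group H'] [MulAction H Y]
    [MulAction H' F] [Fintype Y] [Fintype F] (θ : H ≃* H') (e : Y ≃ F)
    (he : ∀ (h : H) (x : Y), e (h • x) = θ h • e x) :
    OrbitalsCommute H Y ↔ OrbitalsCommute H' F := by
  refine ⟨.of_equiv e fun h => ⟨θ h, he h⟩, .of_equiv e.symm fun h => ⟨θ.symm h, fun y => ?_⟩⟩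
  rw [Equiv.symm_apply_eq, he, θ.apply_symm_apply, e.apply_symm_apply]

theorem OrbitalsCommute.of_subsingleton {H Y : Type*} [Group H] [MulAction H Y] [Fintype Y]
    [Subsingleton Y] : OrbitalsCommute H Y := by
  intro a b _ _
  ext x z
  rw [Matrix.mul_apply, Matrix.mul_apply]
  refine Finset.sum_congr rfl fun y _ => ?_
  rw [Subsingleton.elim z y, Subsingleton.elim x y, mul_comm]

end Cosets

/-! ### The topology of the automorphism group of the tree -/

namespace RootedAut

variable {X : ℕ → Type u}

theorem finite_level [∀ i, Finite (X i)] (n : ℕ) : {v : Vertex X | v.level = n}.Finite := by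
  refine (Set.finite_range fun f : (i : Fin n) → X i => (⟨n, f⟩ : Vertex X)).subset ?_
  rintro ⟨m, f⟩ h
  obtain rfl : m = n := h
  exact ⟨f, rfl⟩

theorem isOpen_levelStabilizer [∀ i, Nonempty (X i)] (n : ℕ) :
    IsOpen (levelStabilizer X n : Set (RootedAut X)) :=
  Subgroup.isOpen_of_mem_nhds _ ((levelBasis X).mem_nhds_one ⟨n, rfl⟩)

theorem isOpen_stabilizer [∀ i, Nonempty (X i)] (v : Vertex X) :
    IsOpen (MulAction.stabilizer (RootedAut X) v : Set (RootedAut X)) :=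
  Subgroup.isOpen_mono (fun g (hg : g ∈ levelStabilizer X v.level) => hg v rfl)
    (isOpen_levelStabilizer v.level)

/-- Levels are finite and preserved, so along an ultrafilter the image of each vertex is eventually
constant. The pointwise limit `σ` is an automorphism, the limit `τ` of the inverses being its
inverse. -/
instance [∀ i, Finite (X i)] [∀ i, Nonempty (X i)] : CompactSpace (RootedAut X) := by
  refine ⟨isCompact_iff_ultrafilter_le_nhds.2 fun F _ => ?_⟩
  have hlim : ∀ a : RootedAut X → RootedAut X, ∀ v : Vertex X, ∃ w, ∀ᶠ g in F, a g • v = w := by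
    intro a v
    obtain ⟨w, -, hw⟩ := (Ultrafilter.eventually_exists_mem_iff
      (P := fun w g => a g • v = w) (finite_level v.level)).1
      (Filter.Eventually.of_forall (f := (F : Filter (RootedAut X)))
        fun g => ⟨a g • v, level_smul (a g) v, rfl⟩)
    exact ⟨w, hw⟩
  choose σ hσ using hlim id
  choose τ hτ using hlim fun g => g⁻¹
  have hleft : ∀ v, τ (σ v) = v := by
    intro v
    obtain ⟨g, hg, hg'⟩ := ((hσ v).and (hτ (σ v))).exists
    rw [← hg', inv_smul_eq_iff]
    exact hg.symm
  have hright : ∀ v, σ (τ v) = v := by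
    intro v
    obtain ⟨g, hg, hg'⟩ := ((hσ (τ v)).and (hτ v)).exists
    rw [← hg, ← hg']
    exact smul_inv_smul g v
  have hadj : ∀ v w, (rootedTree X).Adj (σ v) (σ w) ↔ (rootedTree X).Adj v w := by
    intro v w
    obtain ⟨g, hg, hg'⟩ := ((hσ v).and (hσ w)).exists
    rw [← hg, ← hg']
    exact SimpleGraph.Iso.map_adj_iff g.1
  have hroot : σ (Vertex.root X) = Vertex.root X := by
    obtain ⟨g, hg⟩ := (hσ (Vertex.root X)).exists
    rw [← hg]
    exact smul_root g
  let s : RootedAut X := ⟨⟨⟨σ, τ, hleft, hright⟩, fun {v w} => hadj v w⟩, hroot⟩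
  have hs : ∀ v, s • v = σ v := fun _ => rfl
  refine ⟨s, Set.mem_univ s, ((levelBasis X).nhds_hasBasis s).ge_iff.2 ?_⟩
  rintro _ ⟨n, rfl⟩
  have hev : ∀ᶠ g in (F : Filter (RootedAut X)), ∀ v ∈ {v : Vertex X | v.level = n}, g • v = σ v :=
    (Filter.eventually_all_finite (finite_level n)).2 fun v _ => hσ v
  filter_upwards [hev] with g hg
  refine ⟨s⁻¹ * g, fun v hv => ?_, mul_inv_cancel_left s g⟩
  rw [mul_smul, hg v hv, ← hs v, inv_smul_smul]

theorem isPrefix_smul (g : RootedAut X) {p v : Vertex X} (hl : v.level = p.level + 1)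
    (h : p.IsPrefix v) : (g • p).IsPrefix (g • v) := by
  rcases adj_smul g (show (rootedTree X).Adj p v from Or.inl ⟨hl, h⟩) with h | h
  · exact h.2
  · rw [level_smul, level_smul] at h
    omega

theorem mem_descendants_iff {u w : Vertex X} :
    w ∈ descendants u ↔ w.level = u.level + 1 ∧ u.IsPrefix w := by
  refine ⟨fun h => ⟨h.1, ?_⟩, fun h => ⟨h.1, Or.inl h⟩⟩
  rcases h.2 with h' | h'
  · exact h'.2
  · have := h.1
    omega

theorem descendants_nonempty [∀ i, Nonempty (X i)] (u : Vertex X) : (descendants u).Nonempty := by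
  obtain ⟨m, v⟩ := u
  refine ⟨⟨m + 1, Fin.snoc (α := fun i : Fin (m + 1) => X i) v (Classical.arbitrary (X m))⟩,
    mem_descendants_iff.2 ⟨rfl, Nat.le_succ m, fun i => ?_⟩⟩
  exact Fin.snoc_castSucc (α := fun i : Fin (m + 1) => X i) (Classical.arbitrary (X m)) v i

end RootedAut

open RootedAut

/-- A step towards the root would return to the unique predecessor, the vertex just left. The
induction carries the prefix relation to exclude this. -/
theorem Boundary.level_vertex {X : ℕ → Type u} (ξ : Boundary X) (n : ℕ) :
    (ξ.vertex n).level = n ∧ (ξ.vertex (n + 1)).level = n + 1 ∧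
      (ξ.vertex n).IsPrefix (ξ.vertex (n + 1)) := by
  induction n with
  | zero =>
    have h0 : (ξ.vertex 0).level = 0 := by rw [ξ.vertex_zero]; rfl
    rcases ξ.adj 0 with h | h
    · exact ⟨h0, by omega, h.2⟩
    · omega
  | succ n ih =>
    obtain ⟨h0, h1, hp⟩ := ih
    refine ⟨h1, ?_⟩
    rcases ξ.adj (n + 1) with h | h
    · exact ⟨by omega, h.2⟩
    · exact absurd (parent_unique h.1 (by omega) h.2 hp) (ξ.nonbacktracking n)

/-! ### The levels as sets with a group action -/

section Levels

open MulAction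

variable {X : ℕ → Type u}

/-- The `n`-th level of the tree. -/
def LevelSet (X : ℕ → Type u) (n : ℕ) : Type u := {v : Vertex X // v.level = n}

instance (n : ℕ) [∀ i, Finite (X i)] : Finite (LevelSet X n) := finite_level n

instance (G : Subgroup (RootedAut X)) (n : ℕ) : MulAction G (LevelSet X n) where
  smul g v := ⟨g.1 • v.1, (level_smul g.1 v.1).trans v.2⟩
  one_smul v := Subtype.ext (one_smul (RootedAut X) v.1)
  mul_smul g h v := Subtype.ext (mul_smul g.1 h.1 v.1)

variable {G : Subgroup (RootedAut X)}

theorem LevelSet.level_coe {n : ℕ} (v : LevelSet X n) : v.1.level = n := v.2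

theorem LevelSet.stabilizer_eq {n : ℕ} (v : LevelSet X n) :
    vertexStabilizer G v.1 = stabilizer G v := by
  ext g
  rw [mem_stabilizer_iff, mem_stabilizer_iff]
  exact ⟨fun h => Subtype.ext h, fun h => congrArg Subtype.val h⟩

theorem IsSphericallyTransitive.isPretransitive_levelSet (hG : IsSphericallyTransitive G) (n : ℕ) :
    IsPretransitive G (LevelSet X n) where
  exists_smul_eq u v := by
    obtain ⟨g, hg, h⟩ := hG u.1 v.1 (u.2.trans v.2.symm)
    exact ⟨⟨g, hg⟩, Subtype.ext h⟩

variable (G) in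
/-- The map which sends a vertex of level `n + 1` to its predecessor. -/
noncomputable def parentMap (n : ℕ) : LevelSet X (n + 1) →[G] LevelSet X n where
  toFun v := ⟨(exists_parent v.1 v.2).choose, (exists_parent v.1 v.2).choose_spec.1⟩
  map_smul' g v := by
    have h := (exists_parent v.1 v.2).choose_spec
    have h' := (exists_parent (g • v).1 (g • v).2).choose_spec
    have hl := v.2.trans (congrArg (· + 1) h.1.symm)
    have hl' := (g • v).2.trans (congrArg (· + 1) h'.1.symm)
    refine Subtype.ext (parent_unique hl' ?_ h'.2 (isPrefix_smul g.1 hl h.2))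
    exact (level_smul g.1 v.1).trans (hl.trans (congrArg (· + 1) (level_smul g.1 _).symm))

theorem parentMap_eq_iff {n : ℕ} {w : LevelSet X (n + 1)} {v : LevelSet X n} :
    parentMap G n w = v ↔ w.1 ∈ descendants v.1 := by
  have h := (exists_parent w.1 w.2).choose_spec
  have hl := w.2.trans (congrArg (· + 1) h.1.symm)
  rw [mem_descendants_iff]
  constructor
  · rintro rfl
    exact ⟨hl, h.2⟩
  · rintro ⟨hl', hp⟩
    exact Subtype.ext (parent_unique hl hl' h.2 hp)

theorem parentMap_surjective [∀ i, Nonempty (X i)] (n : ℕ) :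
    Function.Surjective (parentMap G n) := by
  intro v
  obtain ⟨w, hw⟩ := descendants_nonempty v.1
  exact ⟨⟨w, by rw [← LevelSet.level_coe v]; exact hw.1⟩, parentMap_eq_iff.2 hw⟩

theorem isPretransitive_equivariantFiber {G Y Z : Type*} [Group G] [MulAction G Y] [MulAction G Z]
    [IsPretransitive G Z] (p : Z →[G] Y) (y : Y) :
    IsPretransitive (stabilizer G y) (equivariantFiber p y) where
  exists_smul_eq x z := by
    obtain ⟨g, hg⟩ := exists_smul_eq G (x : Z) z
    have hx : p x = y := x.2
    have hz : p z = y := z.2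
    refine ⟨⟨g, ?_⟩, Subtype.ext hg⟩
    rw [← hg, map_smul, hx] at hz
    exact hz

theorem IsLocallyTwoTransitive.exists_smul_eq_smul_eq (hG : IsLocallyTwoTransitive G) {n : ℕ}
    (x z x' z' : LevelSet X (n + 1)) (hx : parentMap G n x = parentMap G n x')
    (hz : parentMap G n z = parentMap G n z') (hne : parentMap G n x ≠ parentMap G n z) :
    ∃ g : G, g • x = x' ∧ g • z = z' := by
  obtain ⟨g, hg, -, h, h'⟩ := hG.2 (parentMap G n x).1 (parentMap G n z).1
    ((LevelSet.level_coe _).trans (LevelSet.level_coe _).symm) (fun h => hne (Subtype.ext h))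
    x.1 (parentMap_eq_iff.1 rfl) z.1 (parentMap_eq_iff.1 rfl)
    x'.1 (parentMap_eq_iff.1 hx.symm) z'.1 (parentMap_eq_iff.1 hz.symm)
  exact ⟨⟨g, hg⟩, Subtype.ext h, Subtype.ext h'⟩

theorem antitone_vertexStabilizer_boundary (G : Subgroup (RootedAut X)) (ξ : Boundary X) :
    Antitone fun n => vertexStabilizer G (ξ.vertex n) := by
  refine antitone_nat_of_succ_le fun n g hg => ?_
  obtain ⟨h0, h1, hp⟩ := ξ.level_vertex n
  have hg : g.1 • ξ.vertex (n + 1) = ξ.vertex (n + 1) := hg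
  have hp' := isPrefix_smul g.1 (by omega) hp
  rw [hg] at hp'
  refine parent_unique ?_ (by omega) hp' hp
  exact h1.trans (congrArg (· + 1) (h0.symm.trans (level_smul g.1 _).symm))

theorem isOpen_vertexStabilizer [∀ i, Nonempty (X i)] (G : Subgroup (RootedAut X)) (v : Vertex X) :
    IsOpen (vertexStabilizer G v : Set G) :=
  (isOpen_stabilizer v).preimage continuous_subtype_val

/-- D(v) is the fibre of the parent map over v, and St_G(v) acts transitively on it with St_G(u) as
the stabiliser of u. -/
theorem isGelfandPair_vertexStabilizer_iff [∀ i, Nonempty (X i)]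
    (hG : IsSphericallyTransitive G) {n : ℕ}
    (v : LevelSet X n) {u : Vertex X} (hu : u ∈ descendants v.1)
    [Fintype (equivariantFiber (parentMap G n) v)] :
    IsGelfandPair ((vertexStabilizer G u).subgroupOf (vertexStabilizer G v.1)) ↔
      OrbitalsCommute (stabilizer G v) (equivariantFiber (parentMap G n) v) := by
  have := hG.isPretransitive_levelSet (n + 1)
  have := isPretransitive_equivariantFiber (parentMap G n) v
  let w : LevelSet X (n + 1) := ⟨u, by rw [← LevelSet.level_coe v]; exact hu.1⟩
  obtain ⟨e, he⟩ := exists_quotient_equiv (MulEquiv.subgroupCongr v.stabilizer_eq)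
    ((vertexStabilizer G u).subgroupOf (vertexStabilizer G v.1))
    (⟨w, parentMap_eq_iff.2 hu⟩ : equivariantFiber (parentMap G n) v) fun h => by
      rw [Subgroup.mem_subgroupOf, mem_stabilizer_iff]
      exact ⟨fun hh => Subtype.ext (Subtype.ext hh),
        fun hh => congrArg (fun x : equivariantFiber (parentMap G n) v => x.1.1) hh⟩
  have : Fintype (vertexStabilizer G v.1 ⧸
      (vertexStabilizer G u).subgroupOf (vertexStabilizer G v.1)) := Fintype.ofEquiv _ e.symm
  rw [isGelfandPair_iff_orbitalsCommute
    ((isOpen_vertexStabilizer G u).preimage continuous_subtype_val)]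
  exact orbitalsCommute_iff_of_equiv _ e he

end Levels

/-! ### Reduction to finite levels, and induction on the level -/

section LocalGlobal

open MulAction

variable {X : ℕ → Type u} [∀ i, Finite (X i)] [∀ i, Nonempty (X i)] {G : Subgroup (RootedAut X)}

/-- By compactness, a locally constant function on `G ⧸ P_ξ` only depends on the image of a vertex
on the path `ξ`. -/
theorem exists_factor_vertexStabilizer (hclosed : IsClosed (G : Set (RootedAut X))) (ξ : Boundary X)
    (hanti : Antitone fun n => vertexStabilizer G (ξ.vertex n))
    (f : LocallyConstant (G ⧸ parabolic G ξ) ℂ) :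
    ∃ n, ∀ g : G, ∀ k ∈ vertexStabilizer G (ξ.vertex n),
      f ((g * k : G) : G ⧸ parabolic G ξ) = f (g : G ⧸ parabolic G ξ) := by
  have : CompactSpace G := isCompact_iff_compactSpace.1 hclosed.isCompact
  by_contra! hcon
  let F : G × G → ℂ × ℂ := fun x =>
    (f ((x.1 * x.2 : G) : G ⧸ parabolic G ξ), f (x.1 : G ⧸ parabolic G ξ))
  have hF : IsLocallyConstant F :=
    (f.isLocallyConstant.comp_continuous
      (QuotientGroup.continuous_mk.comp continuous_mul)).prodMk
    (f.isLocallyConstant.comp_continuous (QuotientGroup.continuous_mk.comp continuous_fst))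
  -- The pairs violating the claim at `n` form a decreasing sequence of nonempty closed sets. In a
  -- common point `(g, k)`, `k` fixes every vertex of ξ, so `g * k` and `g` have the same coset, a
  -- contradiction.
  let C : ℕ → Set (G × G) := fun n =>
    Prod.snd ⁻¹' (vertexStabilizer G (ξ.vertex n) : Set G) ∩ F ⁻¹' {c | c.1 ≠ c.2}
  have hC : ∀ n, IsClosed (C n) := fun n =>
    ((Subgroup.isClosed_of_isOpen _ (isOpen_vertexStabilizer G _)).preimage continuous_snd).inter
      (isOpen_compl_iff.1 (hF {c | c.1 ≠ c.2}ᶜ))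
  obtain ⟨⟨g, k⟩, hgk⟩ := IsCompact.nonempty_iInter_of_sequence_nonempty_isCompact_isClosed C
    (fun n => Set.inter_subset_inter_left _ (Set.preimage_mono (hanti (Nat.le_succ n))))
    (fun n => by
      obtain ⟨g, k, hk, hne⟩ := hcon n
      exact ⟨(g, k), hk, hne⟩)
    (hC 0).isCompact hC
  rw [Set.mem_iInter] at hgk
  have hk : k ∈ parabolic G ξ := Boundary.ext (funext fun n => (hgk n).1)
  refine (hgk 0).2 ?_
  change f ((g * k : G) : G ⧸ parabolic G ξ) = f (g : G ⧸ parabolic G ξ)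
  rw [QuotientGroup.mk_mul_of_mem g hk]

theorem isGelfandPair_parabolic_iff (hclosed : IsClosed (G : Set (RootedAut X)))
    (hG : IsSphericallyTransitive G) (ξ : Boundary X) [∀ n, Fintype (LevelSet X n)] :
    IsGelfandPair (parabolic G ξ) ↔ ∀ n, OrbitalsCommute G (LevelSet X n) := by
  have hequiv : ∀ n, ∃ e : G ⧸ vertexStabilizer G (ξ.vertex n) ≃ LevelSet X n,
      ∀ (h : G) (x : G ⧸ vertexStabilizer G (ξ.vertex n)), e (h • x) = h • e x := by
    intro n
    have := hG.isPretransitive_levelSet n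
    exact exists_quotient_equiv (MulEquiv.refl G) _ (⟨ξ.vertex n, (ξ.level_vertex n).1⟩ : LevelSet X n)
      fun h => by rw [LevelSet.stabilizer_eq (⟨ξ.vertex n, (ξ.level_vertex n).1⟩ : LevelSet X n)]; rfl
  choose e he using hequiv
  have : ∀ n, Fintype (G ⧸ vertexStabilizer G (ξ.vertex n)) := fun n =>
    Fintype.ofEquiv _ (e n).symm
  have hanti := antitone_vertexStabilizer_boundary G ξ
  rw [isGelfandPair_iff_forall_orbitalsCommute (fun n => vertexStabilizer G (ξ.vertex n)) hanti
    (fun n g (hg : g • ξ = ξ) => mem_stabilizer_iff.2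
      (congrArg (fun η : Boundary X => η.vertex n) hg))
    (fun n => isOpen_vertexStabilizer G _) (exists_factor_vertexStabilizer hclosed ξ hanti)]
  exact forall_congr' fun n => orbitalsCommute_iff_of_equiv (MulEquiv.refl G) (e n) (he n)

end LocalGlobal

theorem theorem1p2 (X : ℕ → Type u) [∀ i, Finite (X i)] [∀ i, Nontrivial (X i)]
    (G : Subgroup (RootedAut X)) (hclosed : IsClosed (G : Set (RootedAut X)))
    (hG : IsLocallyTwoTransitive G) (ξ : Boundary X) :
    IsGelfandPair (parabolic G ξ) ↔
      ∀ v : Vertex X, ∀ u ∈ descendants v,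
        IsGelfandPair ((vertexStabilizer G u).subgroupOf (vertexStabilizer G v)) := by
  have (n : ℕ) : Fintype (LevelSet X n) := Fintype.ofFinite _
  have (n : ℕ) (v : LevelSet X n) : Fintype (equivariantFiber (parentMap G n) v) :=
    Fintype.ofFinite _
  have := fun n => hG.1.isPretransitive_levelSet n
  rw [isGelfandPair_parabolic_iff hclosed hG.1 ξ]
  constructor
  · intro h v u hu
    obtain ⟨n, w, rfl⟩ : ∃ (n : ℕ) (w : LevelSet X n), w.1 = v := ⟨v.level, ⟨v, rfl⟩, rfl⟩
    exact (isGelfandPair_vertexStabilizer_iff hG.1 w hu).2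
      ((h (n + 1)).equivariantFiber (parentMap G n) w)
  · intro h n
    induction n with
    | zero =>
      -- The induction starts at the root, the only vertex of level 0.
      have : Subsingleton (LevelSet X 0) := by
        refine ⟨?_⟩
        rintro ⟨⟨m, x⟩, hx⟩ ⟨⟨m', x'⟩, hx'⟩
        obtain rfl : m = 0 := hx
        obtain rfl : m' = 0 := hx'
        exact Subtype.ext (congrArg (Sigma.mk 0) (funext fun i => i.elim0))
      exact .of_subsingleton
    | succ n ih =>
      refine .of_base_of_fibers (parentMap G n) (parentMap_surjective n)
        hG.exists_smul_eq_smul_eq ih fun v => ?_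
      obtain ⟨u, hu⟩ := descendants_nonempty v.1
      exact (isGelfandPair_vertexStabilizer_iff hG.1 v hu).1 (h v.1 u hu)
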